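/- Theorem 4.2. For a permutation $\pi$ of $\{1,\dots,n\}$ and a permutation $\sigma$ of $\{1,\dots,k\}$, say that $\pi$ contains $\sigma$ if there are indices $i_1<\dots<i_k$ such that $\pi(i_1),\dots,\pi(i_k)$ are in the same relative order as $\sigma(1),\dots,\sigma(k)$; otherwise $\pi$ avoids $\sigma$. For $n\ge 1$ let $a_n$ be the number of permutations of $\{1,\dots,n\}$ that avoid both $4312$ and $3142$ (written in one-line notation), and let $$f=\sum_{n\ge 1}a_n x^n\in\mathbb{Z}[[x]]$$ be the generating function of the nonempty permutations in $\operatorname{Av}(4312,3142)$. Then $$(x^3-2x^2+x)f^4+(4x^3-9x^2+6x-1)f^3+(6x^3-12x^2+7x-1)f^2+(4x^3-5x^2+x)f+x^3=0 .$$ -/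

import Mathlib

/-- The permutation `π` of length `n` contains the pattern `σ` of length `k`: some `k` positions
`e 0 < e 1 < ... < e (k - 1)` carry a subsequence of `π` that is order isomorphic to `σ`. -/
def ContainsPattern {n k : ℕ} (π : Equiv.Perm (Fin n)) (σ : Equiv.Perm (Fin k)) : Prop :=
  ∃ e : Fin k ↪o Fin n, ∀ i j : Fin k, π (e i) < π (e j) ↔ σ i < σ j

/-- The permutations of length `n` in the class `Av(B)`: those containing no pattern from `B`. -/
def avoiders (B : Set (Σ k : ℕ, Equiv.Perm (Fin k))) (n : ℕ) : Set (Equiv.Perm (Fin n)) :=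
  {π | ∀ β ∈ B, ¬ ContainsPattern π β.2}

/-- The generating function `∑_{n ≥ 1} |Av_n(B)| x ^ n` of the nonempty permutations in `Av(B)`
(the constant term is `0`). -/
noncomputable def avGenFun (B : Set (Σ k : ℕ, Equiv.Perm (Fin k))) : PowerSeries ℤ :=
  PowerSeries.mk fun n => if n = 0 then 0 else ((avoiders B n).ncard : ℤ)

/-- The permutation with one-line notation 4312 (positions and values are shifted to start
at `0`). -/
def perm4312 : Equiv.Perm (Fin 4) where
  toFun := ![3, 2, 0, 1]
  invFun := ![2, 3, 1, 0]
  left_inv := by decide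
  right_inv := by decide

/-- The permutation with one-line notation 3142 (positions and values are shifted to start
at `0`). -/
def perm3142 : Equiv.Perm (Fin 4) where
  toFun := ![2, 0, 3, 1]
  invFun := ![1, 3, 0, 2]
  left_inv := by decide
  right_inv := by decide

/-! Permutations are handled as lists, and patterns as sublists. Deleting the maximum of a nonempty
member of the class, but remembering where it stood, leaves a pair (α, β). With F = 1 + f for the
class and A for these pairs (`MaxSplit`), this gives F = 1 + xA.

If β is empty, α is any member of the class. Otherwise write β = γ b δ with b = min β. Avoidance of
312 in β puts γ b below δ in value. Avoidance of 3142 cuts α by position into α₀ α₁ α₂: entries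
below b, entries above b but below all of δ, and entries above some entry of δ. In value the blocks
α₀, then (α₁, γ b), then (α₂, δ) form an ordinal sum. Here α₀ is any member of the class, (α₁, γ) is
again a `MaxSplit` pair, α₂ increases, and its entries never separate the two values of an inversion
of δ. Conversely any such blocks recombine (`maxSplit_iff`), so A = F + F·xA·D.

The pairs (α₂, δ) reduce to the Catalan series c = 1 + xc² of 312-avoiders: D = 1 + xcE and E = D +
xE, where E drops the requirement that each entry of α₂ exceed some entry of δ. Eliminating A, D, E
and c yields the quartic. -/

/-! ### Short sublists of concatenations and images. -/

theorem pair_sublist_append {a b : ℕ} {l m : List ℕ} :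
    [a, b].Sublist (l ++ m) ↔ [a, b].Sublist l ∨ (a ∈ l ∧ b ∈ m) ∨ [a, b].Sublist m := by
  induction l with
  | nil => simp
  | cons x l ih => simp only [List.cons_append, List.sublist_cons_iff]; simp; grind

theorem triple_sublist_append {a b c : ℕ} {l m : List ℕ} :
    [a, b, c].Sublist (l ++ m) ↔ [a, b, c].Sublist l ∨ ([a, b].Sublist l ∧ c ∈ m) ∨
      (a ∈ l ∧ [b, c].Sublist m) ∨ [a, b, c].Sublist m := by
  induction l with
  | nil => simp
  | cons x l ih =>
    simp only [List.cons_append, List.sublist_cons_iff, ih]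
    simp [pair_sublist_append]
    grind

theorem quadruple_sublist_append {a b c d : ℕ} {l m : List ℕ} :
    [a, b, c, d].Sublist (l ++ m) ↔ [a, b, c, d].Sublist l ∨ ([a, b, c].Sublist l ∧ d ∈ m) ∨
      ([a, b].Sublist l ∧ [c, d].Sublist m) ∨
      (a ∈ l ∧ [b, c, d].Sublist m) ∨ [a, b, c, d].Sublist m := by
  induction l with
  | nil => simp
  | cons x l ih =>
    simp only [List.cons_append, List.sublist_cons_iff, ih]
    simp [triple_sublist_append]
    grind

theorem pair_sublist_map {f : ℕ → ℕ} {l : List ℕ} {a b : ℕ} :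
    [a, b].Sublist (l.map f) ↔ ∃ a' b', [a', b'].Sublist l ∧ f a' = a ∧ f b' = b := by
  rw [List.sublist_map_iff]
  constructor
  · rintro ⟨l', h, e⟩
    match l', h, e with
    | [a', b'], h, e => exact ⟨a', b', h, by simpa [eq_comm] using e⟩
  · rintro ⟨a', b', h, rfl, rfl⟩
    exact ⟨_, h, rfl⟩

theorem triple_sublist_map {f : ℕ → ℕ} {l : List ℕ} {a b c : ℕ} :
    [a, b, c].Sublist (l.map f) ↔
      ∃ a' b' c', [a', b', c'].Sublist l ∧ f a' = a ∧ f b' = b ∧ f c' = c := by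
  rw [List.sublist_map_iff]
  constructor
  · rintro ⟨l', h, e⟩
    match l', h, e with
    | [a', b', c'], h, e => exact ⟨a', b', c', h, by simpa [eq_comm] using e⟩
  · rintro ⟨a', b', c', h, rfl, rfl, rfl⟩
    exact ⟨_, h, rfl⟩

theorem quadruple_sublist_map {f : ℕ → ℕ} {l : List ℕ} {a b c d : ℕ} :
    [a, b, c, d].Sublist (l.map f) ↔ ∃ a' b' c' d', [a', b', c', d'].Sublist l ∧
      f a' = a ∧ f b' = b ∧ f c' = c ∧ f d' = d := by
  rw [List.sublist_map_iff]
  constructor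
  · rintro ⟨l', h, e⟩
    match l', h, e with
    | [a', b', c', d'], h, e => exact ⟨a', b', c', d', h, by simpa [eq_comm] using e⟩
  · rintro ⟨a', b', c', d', h, rfl, rfl, rfl, rfl⟩
    exact ⟨_, h, rfl⟩

theorem mem_of_pair_sublist {a b : ℕ} {l : List ℕ} (h : [a, b].Sublist l) : a ∈ l ∧ b ∈ l :=
  ⟨h.subset (by simp), h.subset (by simp)⟩

theorem pair_of_triple_sublist {a b c : ℕ} {l : List ℕ} (h : [a, b, c].Sublist l) :
    [a, b].Sublist l ∧ [a, c].Sublist l ∧ [b, c].Sublist l :=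
  ⟨List.Sublist.trans (by simp) h, List.Sublist.trans (by simp) h, List.Sublist.trans (by simp) h⟩

/-- A list splits along a predicate that holds on no entry preceded by a violating entry. -/
theorem exists_append_of_no_inversion (P : ℕ → Prop) (l : List ℕ)
    (h : ∀ x y, [x, y].Sublist l → P y → P x) :
    ∃ l₁ l₂, l = l₁ ++ l₂ ∧ (∀ x ∈ l₁, P x) ∧ ∀ x ∈ l₂, ¬ P x := by
  induction l with
  | nil => exact ⟨[], [], by simp⟩
  | cons a l ih =>
    by_cases ha : P a
    · obtain ⟨l₁, l₂, rfl, h₁, h₂⟩ := ih fun x y hxy => h x y (hxy.cons a)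
      exact ⟨a :: l₁, l₂, by simp, by simpa using ⟨ha, h₁⟩, h₂⟩
    · refine ⟨[], a :: l, rfl, by simp, ?_⟩
      simp only [List.mem_cons, forall_eq_or_imp]
      exact ⟨ha, fun x hx hp => ha (h a x (by simpa using hx) hp)⟩

/-! ### The classes of pairs of lists and the two constructions on them. -/

def Avoids312 (l : List ℕ) : Prop :=
  ∀ a b c, a < b → b < c → ¬ [c, a, b].Sublist l

def Avoids4312And3142 (l : List ℕ) : Prop :=
  ∀ a b c d, a < b → b < c → c < d → ¬ [d, c, a, b].Sublist l ∧ ¬ [c, a, d, b].Sublist l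

/-- The pairs `(α, β)` for which `α M β` avoids 4312 and 3142 when `M` exceeds all entries. -/
structure MaxSplit (p : List ℕ × List ℕ) : Prop where
  left : Avoids4312And3142 p.1
  right : Avoids312 p.2
  inv_asc : ∀ a b c d, a < b → b < c → c < d → [d, c].Sublist p.1 → ¬ [a, b].Sublist p.2
  inv_mem : ∀ a b c, a < b → b < c → [c, a].Sublist p.1 → b ∉ p.2
  mem_132 : ∀ a b c d, a < b → b < c → c < d → c ∈ p.1 → ¬ [a, d, b].Sublist p.2

/-- The pairs `(α, β)` with `α` increasing, `β` avoiding 312, and every entry of `α` lying in a gap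
of values at which `β` is a direct sum. -/
structure GapFilled (p : List ℕ × List ℕ) : Prop where
  left : ∀ x y, [x, y].Sublist p.1 → x < y
  right : Avoids312 p.2
  gap : ∀ y h z, y < h → h < z → h ∈ p.1 → ¬ [z, y].Sublist p.2

def GapFilledAbove (p : List ℕ × List ℕ) : Prop :=
  GapFilled p ∧ ∀ h ∈ p.1, ∃ d ∈ p.2, d < h

def LeftOnly (p : List ℕ × List ℕ) : Prop := Avoids4312And3142 p.1 ∧ p.2 = []

def RightOnly (p : List ℕ × List ℕ) : Prop := p.1 = [] ∧ Avoids312 p.2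

def IsNil (p : List ℕ × List ℕ) : Prop := p = ([], [])

def IsPoint (p : List ℕ × List ℕ) : Prop := ∃ b, p = ([b], [])

/-- The new last entry is the minimum of the whole pair, so it can be located again and contributes
a factor x. -/
def Rooted (P : List ℕ × List ℕ → Prop) (p : List ℕ × List ℕ) : Prop :=
  ∃ α γ b, p = (α, γ ++ [b]) ∧ P (α, γ) ∧ ∀ x ∈ α ++ γ, b < x

def OrdinalSum (P Q : List ℕ × List ℕ → Prop) (p : List ℕ × List ℕ) : Prop :=
  ∃ q r, P q ∧ Q r ∧ (∀ x ∈ q.1 ++ q.2, ∀ y ∈ r.1 ++ r.2, x < y) ∧ p = (q.1 ++ r.1, q.2 ++ r.2)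

/-! ### Structural decompositions. -/

/-- In an occurrence M can only play 4. As such it yields `right` (4312 from M c a b) and `inv_mem`
(3142 from c a M b). Occurrences without M are sorted by how many of their letters lie in α;
`inv_asc` and `mem_132` are the distributions not already excluded by the other conditions. -/
theorem avoids4312And3142_iff_maxSplit {α β : List ℕ} {M : ℕ} (h : ∀ x ∈ α ++ β, x < M) :
    Avoids4312And3142 (α ++ M :: β) ↔ MaxSplit (α, β) := by
  have e : α ++ M :: β = α ++ ([M] ++ β) := rfl
  have s2 : ∀ a b, ¬ [a, b].Sublist [M] := fun a b h => by simpa using h.length_le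
  have s3 : ∀ a b c, ¬ [a, b, c].Sublist [M] := fun a b c h => by simpa using h.length_le
  have s4 : ∀ a b c d, ¬ [a, b, c, d].Sublist [M] := fun a b c d h => by simpa using h.length_le
  have hle : ∀ x ∈ α ++ M :: β, x ≤ M := by
    intro x hx
    simp only [List.mem_append, List.mem_cons] at hx h
    rcases hx with hx | rfl | hx
    exacts [(h x (Or.inl hx)).le, le_rfl, (h x (Or.inr hx)).le]
  constructor
  · intro H
    refine ⟨?_, ?_, ?_, ?_, ?_⟩
    · exact fun a b c d hab hbc hcd =>
        (H a b c d hab hbc hcd).imp (mt (·.trans (by simp))) (mt (·.trans (by simp)))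
    · exact fun a b c hab hbc hs => (H a b c M hab hbc
        (h _ (List.mem_append_right _ (hs.subset (by simp))))).1
          (List.Sublist.append (List.nil_sublist α) (hs.cons_cons M))
    · exact fun a b c d hab hbc hcd h1 h2 => (H a b c d hab hbc hcd).1 (h1.append (h2.cons M))
    · exact fun a b c hab hbc h1 h2 => (H a b c M hab hbc
        (h _ (List.mem_append_left _ (h1.subset (by simp))))).2
          (h1.append (List.Sublist.cons_cons M (by simpa using h2)))
    · exact fun a b c d hab hbc hcd h1 h2 => (H a b c d hab hbc hcd).2
        ((List.singleton_sublist.2 h1).append (h2.cons M))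
  · intro H a b c d hab hbc hcd
    have h1 := H.left a b c d hab hbc hcd
    have h2 := H.right a b c hab hbc
    have h3 := H.inv_asc a b c d hab hbc hcd
    have h4 := H.inv_mem a b c hab hbc
    have h5 := H.mem_132 a b c d hab hbc hcd
    have h6 := H.right a b d hab (by omega)
    have h7 := H.inv_mem a b d hab (by omega)
    simp only at h1 h2 h3 h4 h5 h6 h7
    have key : ∀ t : List ℕ, d ∈ t → t.Sublist (α ++ M :: β) → a ≠ M ∧ b ≠ M ∧ c ≠ M := by
      intro t hd ht
      have := hle d (ht.subset hd)
      omega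
    constructor
    · intro hs
      obtain ⟨ha, hb, hc⟩ := key _ (by simp) hs
      simp only [e, quadruple_sublist_append, triple_sublist_append, pair_sublist_append, s2, s3,
        s4, List.mem_singleton, false_or, List.mem_append, ha, hb, hc, false_and] at hs
      rcases hs with hs | ⟨hs, hs'⟩ | ⟨hs, hs'⟩ | ⟨hs, hs'⟩ | ⟨hs, hs'⟩ | hs
      · exact h1.1 hs
      · exact h7 (pair_of_triple_sublist hs).2.1 hs'
      · exact h3 hs hs'
      · exact h2 hs'
      · exact h2 hs'
      · exact h2 (List.Sublist.trans (by simp) hs)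
    · intro hs
      obtain ⟨ha, hb, hc⟩ := key _ (by simp) hs
      simp only [e, quadruple_sublist_append, triple_sublist_append, pair_sublist_append, s2, s3,
        s4, List.mem_singleton, false_or, List.mem_append, ha, hb, hc, false_and] at hs
      rcases hs with hs | ⟨hs, hs'⟩ | ⟨hs, ⟨-, hs'⟩ | hs'⟩ | ⟨hs, hs'⟩ | hs
      · exact h1.2 hs
      · exact h4 (pair_of_triple_sublist hs).1 hs'
      · exact h4 hs hs'
      · exact h4 hs (mem_of_pair_sublist hs').2
      · exact h5 hs hs'
      · exact h2 (List.Sublist.trans (by simp) hs)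

theorem mem_split_min {β : List ℕ} (hβ : β.Nodup) (h : β ≠ []) :
    ∃ γ b δ, β = γ ++ [b] ++ δ ∧ (∀ x ∈ γ, b < x) ∧ ∀ x ∈ δ, b < x := by
  obtain ⟨b, hb, hmin⟩ := β.toFinset.exists_min_image id (by simpa [List.toFinset_nonempty_iff])
  obtain ⟨γ, δ, rfl⟩ := List.append_of_mem (List.mem_toFinset.1 hb)
  refine ⟨γ, b, δ, by simp, fun x hx => ?_, fun x hx => ?_⟩
  · refine lt_of_le_of_ne (hmin x (by simp [hx])) ?_
    rintro rfl
    grind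
  · refine lt_of_le_of_ne (hmin x (by simp [hx])) ?_
    rintro rfl
    grind

theorem Avoids312.append_min {γ δ : List ℕ} {b : ℕ} (hγ : Avoids312 γ) (hδ : Avoids312 δ)
    (hb : ∀ x ∈ γ, b < x) (h : ∀ x ∈ γ ++ [b], ∀ y ∈ δ, x < y) : Avoids312 (γ ++ [b] ++ δ) := by
  have s2 : ∀ a c, ¬ [a, c].Sublist [b] := fun a b h => by simpa using h.length_le
  have s3 : ∀ a c d, ¬ [a, c, d].Sublist [b] := fun a b c h => by simpa using h.length_le
  intro x y z hxy hyz hs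
  simp only [triple_sublist_append, pair_sublist_append, s2, s3, List.mem_singleton, or_false,
    and_false] at hs
  simp only [List.mem_append, List.mem_singleton] at h
  have := hγ x y z hxy hyz
  have := hδ x y z hxy hyz
  have := @mem_of_pair_sublist
  grind

/-- If x stands before b and exceeds some y after b, then x b y is a 312. -/
theorem Avoids312.lt_of_append_min {γ δ : List ℕ} {b : ℕ} (H : Avoids312 (γ ++ [b] ++ δ))
    (hn : (γ ++ [b] ++ δ).Nodup) (hδ : ∀ y ∈ δ, b < y) : ∀ x ∈ γ ++ [b], ∀ y ∈ δ, x < y := by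
  intro x hx y hy
  by_contra hc
  have hne : x ≠ y := by
    rintro rfl
    exact List.disjoint_of_nodup_append hn hx hy
  have hx' : x ∈ γ := by
    have := hδ y hy
    grind
  refine H b y x (hδ y hy) (by omega) ?_
  simp [triple_sublist_append, hx', hy]

theorem Avoids312.sublist {l m : List ℕ} (h : Avoids312 m) (hs : l.Sublist m) : Avoids312 l :=
  fun a b c hab hbc ht => h a b c hab hbc (ht.trans hs)

/-- The Catalan recursion: cut a 312-avoider just after its minimum. -/
theorem rightOnly_iff (p : List ℕ × List ℕ) (hn : (p.1 ++ p.2).Nodup) :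
    RightOnly p ↔ IsNil p ∨ OrdinalSum (Rooted RightOnly) RightOnly p := by
  obtain ⟨α, β⟩ := p
  simp only [RightOnly, IsNil, OrdinalSum, Rooted, Prod.mk.injEq, Prod.exists]
  constructor
  · rintro ⟨rfl, h⟩
    by_cases hβ : β = []
    · simp [hβ]
    obtain ⟨γ, b, δ, rfl, h1, h2⟩ := mem_split_min (by simpa using hn) hβ
    refine Or.inr ⟨[], γ ++ [b], [], δ, ⟨[], γ, b, ⟨rfl, rfl⟩, ⟨rfl, h.sublist (by simp)⟩, by simpa using h1⟩,
      ⟨rfl, h.sublist (by simp)⟩, ?_, by simp⟩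
    simpa using h.lt_of_append_min (by simpa using hn) h2
  · rintro (⟨rfl, rfl⟩ | ⟨_, _, _, _, ⟨_, γ, b, ⟨rfl, rfl⟩, ⟨rfl, h1⟩, h2⟩, ⟨rfl, h3⟩, h4, rfl, rfl⟩)
    · exact ⟨rfl, by simp [Avoids312]⟩
    · exact ⟨rfl, h1.append_min h3 (by simpa using h2) (by simpa using h4)⟩

/-- If some entry of the increasing list lies below all of δ, so does its first entry, which is then
the global minimum and can be peeled off. -/
theorem gapFilled_iff (p : List ℕ × List ℕ) (hn : (p.1 ++ p.2).Nodup) :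
    GapFilled p ↔ GapFilledAbove p ∨ OrdinalSum IsPoint GapFilled p := by
  obtain ⟨η, δ⟩ := p
  simp only [GapFilledAbove, OrdinalSum, IsPoint, Prod.mk.injEq, Prod.exists]
  constructor
  · intro H
    by_cases hA : ∀ h ∈ η, ∃ d ∈ δ, d < h
    · exact Or.inl ⟨H, hA⟩
    push Not at hA
    obtain ⟨h, hh, hd⟩ := hA
    obtain _ | ⟨a, η⟩ := η
    · simp at hh
    have ha : ∀ x ∈ η, a < x := fun x hx => H.left a x (by simpa using hx)
    refine Or.inr ⟨[a], [], η, δ, ⟨a, rfl, rfl⟩,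
      ⟨fun x y hs => H.left x y (hs.cons a), H.right,
        fun y h z h1 h2 h3 => H.gap y h z h1 h2 (List.mem_cons_of_mem a h3)⟩, ?_, by simp⟩
    simp only [List.append_nil, List.mem_singleton, List.mem_append, forall_eq]
    rintro y (hy | hy)
    · exact ha y hy
    · have := hd y hy
      simp only [List.mem_cons] at hh
      have hne : a ≠ y := by
        rintro rfl
        simp [hy] at hn
      grind
  · rintro (⟨H, -⟩ | ⟨_, _, η, δ, ⟨a, rfl, rfl⟩, H, hlt, rfl, rfl⟩)
    · exact H
    simp only [List.append_nil, List.mem_singleton, List.mem_append, forall_eq] at hlt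
    refine ⟨fun x y hs => ?_, H.right, fun y h z hyh hhz hh hs => ?_⟩
    · rw [List.singleton_append, List.sublist_cons_iff] at hs
      rcases hs with hs | ⟨r, hr, hs⟩
      · exact H.left x y hs
      · obtain ⟨rfl, rfl⟩ : x = a ∧ [y] = r := by simpa using hr
        exact hlt y (Or.inl (by simpa using hs))
    · simp only [List.mem_append, List.mem_singleton] at hh hs
      rcases hh with rfl | hh
      · have := hlt y (Or.inr (mem_of_pair_sublist hs).2)
        omega
      · exact H.gap y h z hyh hhz hh hs

/-- Every entry of η exceeds b = min β. It also exceeds all of γ, since otherwise it would lie in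
value between b and an entry x of γ, and x b is an inversion of β. Hence γ b splits off at the
bottom. -/
theorem gapFilledAbove_iff (p : List ℕ × List ℕ) (hn : (p.1 ++ p.2).Nodup) :
    GapFilledAbove p ↔ IsNil p ∨ OrdinalSum (Rooted RightOnly) GapFilled p := by
  obtain ⟨η, β⟩ := p
  simp only [GapFilledAbove, RightOnly, IsNil, OrdinalSum, Rooted, Prod.mk.injEq, Prod.exists]
  constructor
  · rintro ⟨H, hA⟩
    by_cases hβ : β = []
    · subst hβ
      refine Or.inl ⟨List.eq_nil_iff_forall_not_mem.2 fun h hh => ?_, rfl⟩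
      simpa using hA h hh
    obtain ⟨γ, b, δ, rfl, h1, h2⟩ := mem_split_min hn.of_append_right hβ
    refine Or.inr ⟨[], γ ++ [b], η, δ, ⟨[], γ, b, ⟨rfl, rfl⟩, ⟨rfl, H.right.sublist (by simp)⟩,
      by simpa using h1⟩, ⟨H.left, H.right.sublist (by simp), fun y h z hyh hhz hh hs =>
        H.gap y h z hyh hhz hh (hs.trans (by simp))⟩, ?_, by simp⟩
    intro x hx y hy
    rw [List.mem_append] at hy
    rcases hy with hy | hy
    · obtain ⟨d, hd, hdy⟩ := hA y hy
      have hby : b < y := by grind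
      have hx : x ∈ γ ∨ x = b := by simpa using hx
      rcases hx with hx | rfl
      · by_contra hc
        have hne : x ≠ y := by
          rintro rfl
          exact List.disjoint_of_nodup_append hn hy (by simp [hx])
        exact H.gap b y x hby (by omega) hy (by simp [pair_sublist_append, hx])
      · exact hby
    · exact H.right.lt_of_append_min hn.of_append_right h2 x hx y hy
  · rintro (⟨rfl, rfl⟩ | ⟨_, _, η, δ, ⟨_, γ, b, ⟨rfl, rfl⟩, ⟨rfl, h1⟩, h2⟩, H, h4, rfl, rfl⟩)
    · exact ⟨⟨by simp, by simp [Avoids312], by simp⟩, by simp⟩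
    simp only [List.nil_append] at h2 h4 ⊢
    refine ⟨⟨H.left, h1.append_min H.right h2 fun x hx y hy => h4 x hx y (by simp [hy]),
      fun y h z hyh hhz hh hs => ?_⟩, fun h hh => ⟨b, by simp, h4 b (by simp) h (by simp [hh])⟩⟩
    have hz : z ∉ γ ++ [b] := fun hz => absurd (h4 z hz h (by simp [hh])) (by omega)
    rw [pair_sublist_append] at hs
    rcases hs with hs | ⟨hs, -⟩ | hs
    · exact hz (mem_of_pair_sublist hs).1
    · exact hz hs
    · exact H.gap y h z hyh hhz hh hs

theorem Avoids4312And3142.sublist {l m : List ℕ} (h : Avoids4312And3142 m) (hs : l.Sublist m) :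
    Avoids4312And3142 l := fun a b c d hab hbc hcd =>
  (h a b c d hab hbc hcd).imp (mt (·.trans hs)) (mt (·.trans hs))

theorem Avoids4312And3142.append {l m : List ℕ} (hl : Avoids4312And3142 l)
    (hm : Avoids4312And3142 m) (h : ∀ x ∈ l, ∀ y ∈ m, x < y) : Avoids4312And3142 (l ++ m) := by
  intro a b c d hab hbc hcd
  have h1 := hl a b c d hab hbc hcd
  have h2 := hm a b c d hab hbc hcd
  simp only [quadruple_sublist_append]
  constructor
  · rintro (hs | ⟨hs, hb⟩ | ⟨hs, hs'⟩ | ⟨hs, hs'⟩ | hs)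
    · exact h1.1 hs
    · have := h d (hs.subset (by simp)) b hb
      omega
    · have := h d (hs.subset (by simp)) b (hs'.subset (by simp))
      omega
    · have := h d hs b (hs'.subset (by simp))
      omega
    · exact h2.1 hs
  · rintro (hs | ⟨hs, hb⟩ | ⟨hs, hs'⟩ | ⟨hs, hs'⟩ | hs)
    · exact h1.2 hs
    · have := h d (hs.subset (by simp)) b hb
      omega
    · have := h c (hs.subset (by simp)) b (hs'.subset (by simp))
      omega
    · have := h c hs b (hs'.subset (by simp))
      omega
    · exact h2.2 hs

theorem avoids4312And3142_of_increasing {l : List ℕ} (h : ∀ x y, [x, y].Sublist l → x < y) :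
    Avoids4312And3142 l := by
  intro a b c d hab hbc hcd
  constructor
  · intro hs
    have := h d c (.trans (by simp) hs)
    omega
  · intro hs
    have := h c a (.trans (by simp) hs)
    omega

theorem maxSplit_iff (p : List ℕ × List ℕ) (hn : (p.1 ++ p.2).Nodup) :
    MaxSplit p ↔ LeftOnly p ∨
      OrdinalSum (OrdinalSum LeftOnly (Rooted MaxSplit)) GapFilledAbove p := by
  obtain ⟨α, β⟩ := p
  simp only [LeftOnly, OrdinalSum, Rooted, Prod.mk.injEq, Prod.exists]
  constructor
  · intro H
    by_cases hβ : β = []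
    · exact Or.inl ⟨H.left, hβ⟩
    obtain ⟨γ, b, δ, rfl, h1, h2⟩ := mem_split_min hn.of_append_right hβ
    have hγδ := H.right.lt_of_append_min hn.of_append_right h2
    have hne : ∀ x ∈ α, ∀ y ∈ γ ++ [b] ++ δ, x ≠ y := by
      rintro x hx _ hy rfl
      exact List.disjoint_of_nodup_append hn hx hy
    -- No inversion of α straddles a value of β, so at each such value the smaller entries of α
    -- precede the larger ones; this allows the two cuts of α.
    have noinv : ∀ d ∈ γ ++ [b] ++ δ, ∀ x y, [x, y].Sublist α → y < d → x < d := by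
      intro d hd x y hs hy
      by_contra hx
      have := hne x (hs.subset (by simp)) d hd
      exact H.inv_mem y d x hy (by omega) hs hd
    obtain ⟨α₀, α', rfl, hα₀, hα'⟩ := exists_append_of_no_inversion (· < b) α
      (noinv b (by simp))
    -- For empty δ the predicate is vacuous and α₂ is empty.
    obtain ⟨α₁, α₂, rfl, hα₁, hα₂⟩ := exists_append_of_no_inversion (fun x => ∀ d ∈ δ, x < d) α'
      fun x y hs hy d hd => noinv d (by simp [hd]) x y (hs.trans (by simp)) (hy d hd)
    push Not at hα₂
    simp only [List.mem_append, not_lt] at hα'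
    have hb₁ : ∀ x ∈ α₁, b < x := fun x hx =>
      lt_of_le_of_ne (hα' x (Or.inl hx)) (hne x (by simp [hx]) b (by simp)).symm
    have hb₂ : ∀ x ∈ α₂, ∃ d ∈ δ, d < x := fun x hx => by
      obtain ⟨d, hd, hdx⟩ := hα₂ x hx
      exact ⟨d, hd, lt_of_le_of_ne hdx (hne x (by simp [hx]) d (by simp [hd])).symm⟩
    refine Or.inr ⟨α₀ ++ α₁, γ ++ [b], α₂, δ, ⟨α₀, [], α₁, γ ++ [b],
      ⟨H.left.sublist (by simp), rfl⟩, ⟨α₁, γ, b, ⟨rfl, rfl⟩, ?_, ?_⟩, ?_, by simp⟩,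
      ⟨⟨?_, H.right.sublist (by simp), ?_⟩, hb₂⟩, ?_, by simp⟩
    · exact ⟨H.left.sublist (by simp), H.right.sublist (by simp),
        fun a b c d hab hbc hcd hs hs' => H.inv_asc a b c d hab hbc hcd
          (hs.trans (by simp)) (hs'.trans (by simp)),
        fun a b c hab hbc hs hs' => H.inv_mem a b c hab hbc
          (hs.trans (by simp)) (by simp [hs']),
        fun a b c d hab hbc hcd hs hs' => H.mem_132 a b c d hab hbc hcd
          (by simp [show c ∈ α₁ from hs]) (hs'.trans (by simp))⟩
    · simp only [List.mem_append]
      rintro x (hx | hx)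
      exacts [hb₁ x hx, h1 x hx]
    · intro x hx y hy
      simp only [List.append_nil, List.mem_append, List.mem_singleton] at hx hy
      have := hα₀ x hx
      rcases hy with hy | hy | rfl
      · exact this.trans (hb₁ y hy)
      · exact this.trans (h1 y hy)
      · exact this
    -- An inversion of α₂ lies above some d in δ, so with b d it would form a 4312.
    · intro x y hs
      by_contra hc
      obtain ⟨d, hd, hdy⟩ := hb₂ y (hs.subset (by simp))
      have hxy : x ≠ y := by
        have : [x, y].Nodup := (hn.of_append_left).sublist (hs.trans (by simp))
        simpa using this
      exact H.inv_asc b d y x (h2 d hd) hdy (by omega) (hs.trans (by simp))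
        (by simp [hd])
    -- Prefixing b to the inversion z y gives a 132 which together with h forms a 3142.
    · intro y h z hyh hhz hh hs
      exact H.mem_132 b y h z (h2 y (hs.subset (by simp))) hyh hhz (by simp [show h ∈ α₂ from hh])
        (List.Sublist.append (l₁ := [b]) (by simp) hs)
    · intro x hx y hy
      simp only [List.mem_append] at hy
      have hx' : ∀ d ∈ δ, x < d := by
        intro d hd
        simp only [List.mem_append] at hx
        rcases hx with (hx | hx) | hx
        · exact (hα₀ x hx).trans (h2 d hd)
        · exact hα₁ x hx d hd
        · exact hγδ x (by simpa using hx) d hd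
      rcases hy with hy | hy
      · obtain ⟨d, hd, hdy⟩ := hb₂ y hy
        exact (hx' d hd).trans hdy
      · exact hx' y hy
  · rintro (⟨h, rfl⟩ | ⟨_, _, α₂, δ, ⟨α₀, _, α₁, _, ⟨h0, rfl⟩, ⟨_, γ, b, ⟨rfl, rfl⟩, H, hb⟩, hlt₁,
      rfl, rfl⟩, ⟨G, hd⟩, hlt₂, rfl, rfl⟩)
    · exact ⟨h, by simp [Avoids312], by simp, by simp, by simp⟩
    simp only [List.mem_append, List.nil_append, List.mem_singleton] at hlt₁ hlt₂ hb hd hn ⊢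
    have A0 : ∀ x ∈ α₀, x < b := fun x hx => hlt₁ x (by simp [hx]) b (by simp)
    have Hr := H.right
    have Hia := H.inv_asc
    have Him := H.inv_mem
    have H132 := H.mem_132
    have Gl := G.left
    have Gg := G.gap
    simp only at Hr Hia Him H132 Gl Gg
    have B : ∀ x ∈ γ ++ [b] ++ δ, b ≤ x := by
      simp only [List.mem_append, List.mem_singleton]
      rintro x ((hx | rfl) | hx)
      exacts [(hb x (Or.inr hx)).le, le_rfl, (hlt₂ b (by simp) x (by simp [hx])).le]
    -- The three blocks of α ascend in value and α₂ is increasing, so inversions stay inside α₀ or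
    -- α₁.
    have inv : ∀ x y, y < x → [x, y].Sublist (α₀ ++ α₁ ++ α₂) →
        [x, y].Sublist α₀ ∨ [x, y].Sublist α₁ := by
      intro x y hyx hs
      simp only [pair_sublist_append, List.mem_append] at hs
      rcases hs with (hs | ⟨hx, hy⟩ | hs) | ⟨hx, hy⟩ | hs
      · exact Or.inl hs
      · have := hlt₁ x (by simp [hx]) y (by simp [hy])
        omega
      · exact Or.inr hs
      · have := hlt₂ x (by tauto) y (by simp [hy])
        omega
      · have := Gl x y hs
        omega
    have low : ∀ x ∈ γ ++ [b] ++ δ, ∀ y, x < y → (y ∈ α₀ → False) ∧ (y ∈ α₁ → x ∈ γ ++ [b]) := by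
      intro x hx y hxy
      refine ⟨fun hy => ?_, fun hy => ?_⟩
      · have := A0 y hy
        have := B x hx
        omega
      · by_contra hc
        have := hlt₂ y (by tauto) x (by simp at hx hc; tauto)
        omega
    have notδ : ∀ x ∈ γ ++ [b], x ∉ δ := fun x hx hx' =>
      absurd (hlt₂ x (by simp at hx; tauto) x (by tauto)) (lt_irrefl x)
    -- With this, occurrences whose relevant entries lie in β are pushed back into γ, where the
    -- conditions on (α₁, γ) apply.
    have tail : ∀ x z, [x, z].Sublist (γ ++ [b] ++ δ) → z ∈ γ → [x, z].Sublist γ := by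
      intro x z hs hz
      have h1 := notδ z (by simp [hz])
      have h2 : z ≠ b := (hb z (by tauto)).ne'
      simp only [pair_sublist_append, List.mem_singleton] at hs
      rcases hs with (hs | hs | hs) | hs | hs
      · exact hs
      · exact absurd hs.2 h2
      · exact absurd hs.length_le (by simp)
      · exact absurd hs.2 h1
      · exact absurd (mem_of_pair_sublist hs).2 h1
    refine ⟨?_, ?_, ?_, ?_, ?_⟩
    · refine Avoids4312And3142.append (Avoids4312And3142.append h0 H.left ?_)
        (avoids4312And3142_of_increasing G.left) ?_
      · exact fun x hx y hy => hlt₁ x (by simp [hx]) y (by simp [hy])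
      · exact fun x hx y hy => hlt₂ x (by simpa using Or.inl hx) y (by simp [hy])
    · exact Avoids312.append_min H.right G.right (fun x hx => hb x (by simp [hx]))
        fun x hx y hy => hlt₂ x (by simp at hx; tauto) y (by simp [hy])
    · intro x y z w hxy hyz hzw hs hs'
      obtain ⟨hx, hy⟩ := mem_of_pair_sublist hs'
      rcases inv w z hzw hs with hs | hs
      · exact (low y hy z hyz).1 (mem_of_pair_sublist hs).2
      · have := (low y hy z hyz).2 (mem_of_pair_sublist hs).2
        have hyγ : y ∈ γ := by
          have := B x hx
          have : y ≠ b := by omega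
          simp_all
        exact Hia x y z w hxy hyz hzw hs (tail x y hs' hyγ)
    · intro x y z hxy hyz hs hy
      rcases inv z x (by omega) hs with hs | hs
      · exact (low y (by simpa using hy) z hyz).1 (mem_of_pair_sublist hs).1
      · have h1 := (low y (by simpa using hy) z hyz).2 (mem_of_pair_sublist hs).1
        have h2 := Him x y z hxy hyz hs
        have := hb x (Or.inl (mem_of_pair_sublist hs).2)
        have : y ≠ b := by omega
        simp_all
    · intro x y z w hxy hyz hzw hz hs
      have hx : x ∈ γ ++ [b] ++ δ := hs.subset (by simp)
      have hy : y ∈ γ ++ [b] ++ δ := hs.subset (by simp)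
      have hyb : y ≠ b := by
        have := B x hx
        omega
      simp only [List.mem_append] at hz
      rcases hz with (hz | hz) | hz
      · exact (low y hy z hyz).1 hz
      · have hyγ : y ∈ γ := by
          have := (low y hy z hyz).2 hz
          simp_all
        have h1 := H132 x y z w hxy hyz hzw hz
        have h2 : w ∈ γ := (mem_of_pair_sublist
          (tail w y (pair_of_triple_sublist hs).2.2 hyγ)).1
        have h3 := notδ y (by simp [hyγ])
        simp only [triple_sublist_append, List.mem_singleton, hyb, h3] at hs
        rcases hs with (hs | hs | hs | hs) | hs | hs | hs
        · exact h1 hs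
        · exact hs.2
        · exact absurd hs.2.length_le (by simp)
        · exact absurd hs.length_le (by simp)
        · exact hs.2
        · exact h3 (mem_of_pair_sublist hs.2).2
        · exact h3 (hs.subset (by simp))
      · have hw : w ∉ γ ++ [b] := fun hw => by
          have := hlt₂ w (by simp at hw; tauto) z (by tauto)
          omega
        have hs' := (pair_of_triple_sublist hs).2.2
        rw [pair_sublist_append] at hs'
        rcases hs' with hs' | hs' | hs'
        · exact hw (mem_of_pair_sublist hs').1
        · exact hw hs'.1
        · exact Gg y z w hyz hzw hz hs'

/-! ### Generating functions of classes of pairs. -/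

/-- The pairs of lists satisfying `P` that together arrange `0, …, n - 1`. -/
def labelled (P : List ℕ × List ℕ → Prop) (n : ℕ) : Set (List ℕ × List ℕ) :=
  {p | P p ∧ (p.1 ++ p.2).Perm (List.range n)}

noncomputable def genFun (P : List ℕ × List ℕ → Prop) : PowerSeries ℤ :=
  PowerSeries.mk fun n => ((labelled P n).ncard : ℤ)

theorem finite_perm_range (n : ℕ) : {l : List ℕ | l.Perm (List.range n)}.Finite := by
  refine (List.finite_toSet (List.range n).permutations).subset fun l hl => ?_
  simpa using hl

theorem labelled_finite (P : List ℕ × List ℕ → Prop) (n : ℕ) : (labelled P n).Finite := by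
  -- A pair is recovered from its concatenation and the length of its first list.
  refine Set.Finite.of_finite_image (f := fun p => (p.1 ++ p.2, p.1.length)) ?_ ?_
  · refine ((finite_perm_range n).prod (Set.finite_Iic n)).subset ?_
    rintro _ ⟨p, ⟨-, hp⟩, rfl⟩
    have := hp.length_eq
    simp only [List.length_append, List.length_range] at this
    exact ⟨hp, by simp; omega⟩
  · rintro ⟨a, b⟩ - ⟨c, d⟩ - h
    simp only [Prod.mk.injEq] at h ⊢
    exact List.append_inj h.1 h.2

theorem genFun_congr {P Q : List ℕ × List ℕ → Prop}
    (h : ∀ p, (p.1 ++ p.2).Nodup → (P p ↔ Q p)) : genFun P = genFun Q := by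
  ext n
  simp only [genFun, PowerSeries.coeff_mk, labelled]
  congr 3
  ext p
  exact and_congr_left fun hp => h p (hp.nodup_iff.2 List.nodup_range)

theorem genFun_or {P Q : List ℕ × List ℕ → Prop} (h : ∀ p, P p → ¬ Q p) :
    genFun (fun p => P p ∨ Q p) = genFun P + genFun Q := by
  ext n
  simp only [genFun, PowerSeries.coeff_mk, map_add]
  rw [← Nat.cast_add, ← Set.ncard_union_eq _ (labelled_finite P n) (labelled_finite Q n)]
  · congr 2
    ext p
    simp [labelled, or_and_right]
  · exact Set.disjoint_left.2 fun p hp hq => h p hp.1 hq.1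

theorem genFun_isNil : genFun IsNil = 1 := by
  ext n
  simp only [genFun, PowerSeries.coeff_mk, PowerSeries.coeff_one]
  split_ifs with h
  · subst h
    rw [show labelled IsNil 0 = {([], [])} by ext p; simp +contextual [labelled, IsNil]]
    simp
  · rw [show labelled IsNil n = ∅ by
      ext p
      simp only [labelled, IsNil, Set.mem_ofPred_eq, Set.mem_empty_iff_false, iff_false, not_and]
      rintro rfl hp
      simpa [eq_comm, h] using hp.length_eq]
    simp

theorem genFun_isPoint : genFun IsPoint = PowerSeries.X := by
  ext n
  simp only [genFun, PowerSeries.coeff_mk, PowerSeries.coeff_X]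
  split_ifs with h
  · subst h
    rw [show labelled IsPoint 1 = {([0], [])} by
      ext p
      simp only [labelled, IsPoint, Set.mem_ofPred_eq, Set.mem_singleton_iff]
      constructor
      · rintro ⟨⟨b, rfl⟩, hb⟩
        simpa using hb
      · rintro rfl
        exact ⟨⟨0, rfl⟩, by simp⟩]
    simp
  · rw [show labelled IsPoint n = ∅ by
      ext p
      simp only [labelled, IsPoint, Set.mem_ofPred_eq, Set.mem_empty_iff_false, iff_false, not_and]
      rintro ⟨b, rfl⟩ hp
      simpa [eq_comm, h] using hp.length_eq]
    simp

/-! ### Invariance under relabelling. -/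

/-- Properties of pairs of lists that depend only on the relative order of the entries. -/
def OrderInvariant (P : List ℕ × List ℕ → Prop) : Prop :=
  ∀ f : ℕ → ℕ, StrictMono f → ∀ p, P (p.1.map f, p.2.map f) ↔ P p

theorem avoids312_map {f : ℕ → ℕ} (hf : StrictMono f) (l : List ℕ) :
    Avoids312 (l.map f) ↔ Avoids312 l := by
  constructor
  · intro h a b c hab hbc hs
    exact h _ _ _ (hf hab) (hf hbc) (hs.map f)
  · intro h a b c hab hbc hs
    obtain ⟨c, a, b, hs', rfl, rfl, rfl⟩ := triple_sublist_map.1 hs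
    exact h a b c (hf.lt_iff_lt.1 hab) (hf.lt_iff_lt.1 hbc) hs'

theorem avoids4312And3142_map {f : ℕ → ℕ} (hf : StrictMono f) (l : List ℕ) :
    Avoids4312And3142 (l.map f) ↔ Avoids4312And3142 l := by
  constructor
  · intro h a b c d hab hbc hcd
    exact (h _ _ _ _ (hf hab) (hf hbc) (hf hcd)).imp (mt (·.map f)) (mt (·.map f))
  · intro h a b c d hab hbc hcd
    constructor
    · intro hs
      obtain ⟨d, c, a, b, hs', rfl, rfl, rfl, rfl⟩ := quadruple_sublist_map.1 hs
      rw [hf.lt_iff_lt] at hab hbc hcd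
      exact (h a b c d hab hbc hcd).1 hs'
    · intro hs
      obtain ⟨c, a, d, b, hs', rfl, rfl, rfl, rfl⟩ := quadruple_sublist_map.1 hs
      rw [hf.lt_iff_lt] at hab hbc hcd
      exact (h a b c d hab hbc hcd).2 hs'

theorem orderInvariant_rightOnly : OrderInvariant RightOnly := fun f hf p => by
  simp [RightOnly, avoids312_map hf]

theorem orderInvariant_gapFilled : OrderInvariant GapFilled := by
  intro f hf p
  constructor
  · rintro ⟨h1, h2, h3⟩
    refine ⟨fun x y hs => hf.lt_iff_lt.1 (h1 _ _ (hs.map f)), (avoids312_map hf _).1 h2, ?_⟩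
    exact fun y h z hyh hhz hh hs =>
      h3 _ _ _ (hf hyh) (hf hhz) (List.mem_map_of_mem hh) (hs.map f)
  · rintro ⟨h1, h2, h3⟩
    refine ⟨fun x y hs => ?_, (avoids312_map hf _).2 h2, fun y h z hyh hhz hh hs => ?_⟩
    · obtain ⟨x, y, hs', rfl, rfl⟩ := pair_sublist_map.1 hs
      exact hf (h1 x y hs')
    · obtain ⟨z, y, hs', rfl, rfl⟩ := pair_sublist_map.1 hs
      obtain ⟨h, hh', rfl⟩ := List.mem_map.1 hh
      exact h3 y h z (hf.lt_iff_lt.1 hyh) (hf.lt_iff_lt.1 hhz) hh' hs'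

theorem orderInvariant_gapFilledAbove : OrderInvariant GapFilledAbove := fun f hf p => by
  simp [GapFilledAbove, orderInvariant_gapFilled f hf p, hf.lt_iff_lt]

theorem orderInvariant_maxSplit : OrderInvariant MaxSplit := by
  intro f hf p
  -- Inserting any bound M turns the claim into the invariance of avoidance by a single list.
  obtain ⟨M, hM⟩ : ∃ M, ∀ x ∈ p.1 ++ p.2, x < M := by
    refine ⟨(p.1 ++ p.2).sum + 1, fun x hx => ?_⟩
    have := List.le_sum_of_mem hx
    omega
  rw [← avoids4312And3142_iff_maxSplit hM, ← avoids4312And3142_map hf, List.map_append,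
    List.map_cons, avoids4312And3142_iff_maxSplit]
  simp only [← List.map_append, List.mem_map, forall_exists_index, and_imp,
    forall_apply_eq_imp_iff₂, hf.lt_iff_lt]
  exact hM

theorem OrderInvariant.rooted {P : List ℕ × List ℕ → Prop} (hP : OrderInvariant P) :
    OrderInvariant (Rooted P) := by
  rintro f hf ⟨α, β⟩
  simp only [Rooted, Prod.mk.injEq]
  constructor
  · rintro ⟨_, γ, b, ⟨rfl, hβ⟩, h, hb⟩
    obtain ⟨γ, t, rfl, rfl, ht⟩ := List.map_eq_append_iff.1 hβ
    obtain ⟨b, rfl, rfl⟩ : ∃ b', t = [b'] ∧ f b' = b := by simpa using ht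
    refine ⟨α, γ, b, ⟨rfl, rfl⟩, (hP f hf (α, γ)).1 h, fun x hx => hf.lt_iff_lt.1 (hb _ ?_)⟩
    rw [← List.map_append]
    exact List.mem_map_of_mem hx
  · rintro ⟨_, γ, b, ⟨rfl, rfl⟩, h, hb⟩
    refine ⟨_, γ.map f, f b, ⟨rfl, by simp⟩, (hP f hf (_, γ)).2 h, ?_⟩
    rw [← List.map_append]
    simp only [List.mem_map, forall_exists_index, and_imp, forall_apply_eq_imp_iff₂, hf.lt_iff_lt]
    exact hb

/-! ### Product rules for `Rooted` and `OrdinalSum`. -/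

/-- Sorting l and m separately already sorts l ++ m, so the two sorted lists are an initial segment
of the range and the rest. -/
theorem perm_range_of_append {l m : List ℕ} {n : ℕ} (h : (l ++ m).Perm (List.range n))
    (hlt : ∀ x ∈ l, ∀ y ∈ m, x < y) : l.Perm (List.range l.length) ∧
      m.Perm ((List.range m.length).map (l.length + ·)) := by
  have hp : (l.mergeSort (· ≤ ·) ++ m.mergeSort (· ≤ ·)).Perm (List.range n) :=
    ((List.mergeSort_perm _ _).append (List.mergeSort_perm _ _)).trans h
  have hn : n = l.length + m.length := by simpa using h.length_eq.symm
  have he : l.mergeSort (· ≤ ·) ++ m.mergeSort (· ≤ ·) = List.range n := by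
    refine hp.eq_of_pairwise' (r := (· ≤ ·)) ?_ ?_
    · refine List.pairwise_append.2 ⟨List.pairwise_mergeSort' _ _, List.pairwise_mergeSort' _ _, ?_⟩
      intro x hx y hy
      exact (hlt x (by simpa using hx) y (by simpa using hy)).le
    · exact List.pairwise_lt_range.imp le_of_lt
  rw [hn, List.range_add] at he
  obtain ⟨h1, h2⟩ := List.append_inj he (by simp)
  exact ⟨h1 ▸ (List.mergeSort_perm _ _).symm, h2 ▸ (List.mergeSort_perm _ _).symm⟩

theorem exists_map_add_eq {l : List ℕ} {k : ℕ} (h : ∀ x ∈ l, k ≤ x) :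
    ∃ l' : List ℕ, l'.map (k + ·) = l := by
  refine ⟨l.map (· - k), ?_⟩
  rw [List.map_map]
  refine (List.map_congr_left fun x hx => ?_).trans (List.map_id l)
  simp [h x hx]

theorem genFun_rooted {P : List ℕ × List ℕ → Prop} (hP : OrderInvariant P) :
    genFun (Rooted P) = PowerSeries.X * genFun P := by
  ext n
  obtain _ | n := n
  · rw [PowerSeries.coeff_zero_X_mul, genFun, PowerSeries.coeff_mk,
      show labelled (Rooted P) 0 = ∅ by
        ext p
        simp only [labelled, Rooted, Set.mem_ofPred_eq, Set.mem_empty_iff_false, iff_false,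
          not_and]
        rintro ⟨α, γ, b, rfl, -, -⟩
        simp]
    simp
  rw [PowerSeries.coeff_succ_X_mul, genFun, genFun, PowerSeries.coeff_mk, PowerSeries.coeff_mk]
  have hinj : Function.Injective (fun x : ℕ => 1 + x) := add_right_injective 1
  have hmono : StrictMono (fun x : ℕ => 1 + x) := fun a b h => Nat.add_lt_add_left h 1
  rw [← Set.ncard_image_of_injective (labelled P n)
    (f := fun p => (p.1.map (1 + ·), p.2.map (1 + ·) ++ [0]))]
  · congr 2
    ext ⟨α, β⟩
    simp only [labelled, Rooted, Set.mem_ofPred_eq, Set.mem_image, Prod.mk.injEq, Prod.exists]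
    constructor
    · rintro ⟨⟨_, γ, b, ⟨rfl, rfl⟩, h, hb⟩, hp⟩
      have hp' : ([b] ++ (α ++ γ)).Perm (List.range (n + 1)) := by
        refine .trans ?_ hp
        rw [← List.append_assoc α]
        exact List.perm_append_comm
      obtain ⟨h1, h2⟩ := perm_range_of_append hp' (by simpa using hb)
      obtain rfl : b = 0 := by simpa using h1
      have hlen : (α ++ γ).length = n := by simpa using hp'.length_eq
      rw [hlen] at h2
      obtain ⟨α, rfl⟩ := exists_map_add_eq (k := 1) (l := α) fun x hx => hb x (by simp [hx])
      obtain ⟨γ, rfl⟩ := exists_map_add_eq (k := 1) (l := γ) fun x hx => hb x (by simp [hx])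
      refine ⟨α, γ, ⟨(hP _ hmono (α, γ)).1 h, ?_⟩, rfl, rfl⟩
      rw [← List.map_append] at h2
      exact (List.map_perm_map_iff hinj).1 h2
    · rintro ⟨α, γ, ⟨h, hp⟩, rfl, rfl⟩
      refine ⟨⟨_, _, 0, ⟨rfl, rfl⟩, (hP _ hmono (α, γ)).2 h, ?_⟩, ?_⟩
      · rw [← List.map_append]
        simp only [List.mem_map]
        rintro _ ⟨x, -, rfl⟩
        omega
      · rw [← List.append_assoc, ← List.map_append]
        refine List.perm_append_comm.trans ?_
        rw [add_comm n, List.range_add]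
        exact List.Perm.append_left [0] (hp.map _)
  · rintro ⟨a, b⟩ ⟨c, d⟩ h
    simpa [hinj.list_map.eq_iff] using h

/-- A pair of lists is an ordinal sum of a `P` and a `Q` in at most one way. -/
def UniqueSum (P Q : List ℕ × List ℕ → Prop) : Prop :=
  ∀ q r q' r', P q → Q r → P q' → Q r' → (∀ x ∈ q.1 ++ q.2, ∀ y ∈ r.1 ++ r.2, x < y) →
    (∀ x ∈ q'.1 ++ q'.2, ∀ y ∈ r'.1 ++ r'.2, x < y) → (q.2 ++ r.2).Nodup →
    q.1 ++ r.1 = q'.1 ++ r'.1 → q.2 ++ r.2 = q'.2 ++ r'.2 → q = q'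

/-- The lower summand keeps its labels and the upper one is shifted by the size of the lower, so
only `Q` has to be order invariant. Uniqueness of the lower summand is enough, because the upper one
then follows by cancellation. -/
theorem genFun_ordinalSum {P Q : List ℕ × List ℕ → Prop} (hQ : OrderInvariant Q)
    (hu : UniqueSum P Q) : genFun (OrdinalSum P Q) = genFun P * genFun Q := by
  have hinj : ∀ k, Function.Injective (fun x : ℕ => k + x) := add_right_injective
  have hmono : ∀ k, StrictMono (fun x : ℕ => k + x) := fun k a b h => Nat.add_lt_add_left h k
  ext n
  simp only [PowerSeries.coeff_mul, genFun, PowerSeries.coeff_mk]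
  simp only [Set.ncard_eq_toFinset_card _ (labelled_finite _ _), ← Nat.cast_mul,
    ← Nat.cast_sum, ← Finset.card_product]
  rw [← Finset.card_sigma, Nat.cast_inj]
  symm
  have hlt : ∀ {i : ℕ} {q r : List ℕ × List ℕ}, (q.1 ++ q.2).Perm (List.range i) →
      ∀ x ∈ q.1 ++ q.2, ∀ y ∈ r.1.map (i + ·) ++ r.2.map (i + ·), x < y := by
    intro i q r hq x hx y hy
    have := hq.mem_iff.1 hx
    rw [← List.map_append] at hy
    obtain ⟨z, -, rfl⟩ := List.mem_map.1 hy
    simp only [List.mem_range] at this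
    omega
  have hperm : ∀ {i j : ℕ} {q r : List ℕ × List ℕ}, (q.1 ++ q.2).Perm (List.range i) →
      (r.1 ++ r.2).Perm (List.range j) →
      ((q.1 ++ r.1.map (i + ·)) ++ (q.2 ++ r.2.map (i + ·))).Perm (List.range (i + j)) := by
    intro i j q r hq hr
    rw [List.range_add]
    refine .trans ?_ (hq.append (hr.map _))
    simp only [List.append_assoc, List.map_append]
    exact List.Perm.append_left _ (List.perm_append_comm_assoc _ _ _)
  refine Finset.card_bij
    (fun x _ => (x.2.1.1 ++ x.2.2.1.map (x.1.1 + ·), x.2.1.2 ++ x.2.2.2.map (x.1.1 + ·))) ?_ ?_ ?_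
  · rintro ⟨⟨i, j⟩, q, r⟩ hx
    simp only [Finset.mem_sigma, Finset.HasAntidiagonal.mem_antidiagonal, Finset.mem_product,
      Set.Finite.mem_toFinset, labelled, Set.mem_ofPred_eq] at hx ⊢
    obtain ⟨rfl, ⟨hq, hq'⟩, hr, hr'⟩ := hx
    exact ⟨⟨q, _, hq, (hQ _ (hmono i) r).2 hr, hlt hq', rfl⟩, hperm hq' hr'⟩
  · rintro ⟨⟨i, j⟩, q, r⟩ hx ⟨⟨i', j'⟩, q', r'⟩ hx' h
    simp only [Finset.mem_sigma, Finset.HasAntidiagonal.mem_antidiagonal, Finset.mem_product,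
      Set.Finite.mem_toFinset, labelled, Set.mem_ofPred_eq, Prod.mk.injEq] at hx hx' h
    obtain ⟨hij, ⟨hq, hqp⟩, hr, hrp⟩ := hx
    obtain ⟨hij', ⟨hq', hqp'⟩, hr', hrp'⟩ := hx'
    have hnd := (hperm hqp hrp).nodup_iff.2 List.nodup_range
    obtain rfl := hu q _ q' _ hq ((hQ _ (hmono i) r).2 hr) hq' ((hQ _ (hmono i') r').2 hr')
      (hlt hqp) (hlt hqp') hnd.of_append_right h.1 h.2
    obtain rfl : i = i' := by simpa using hqp.length_eq.symm.trans hqp'.length_eq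
    obtain rfl : j = j' := by omega
    obtain rfl : r = r' := Prod.ext ((hinj i).list_map (List.append_cancel_left h.1))
      ((hinj i).list_map (List.append_cancel_left h.2))
    rfl
  · rintro p hp
    simp only [Set.Finite.mem_toFinset, labelled, Set.mem_ofPred_eq] at hp
    obtain ⟨⟨q, r, hq, hr, hqr, rfl⟩, hp⟩ := hp
    have hp' : ((q.1 ++ q.2) ++ (r.1 ++ r.2)).Perm (List.range n) := by
      refine .trans ?_ hp
      simp only [List.append_assoc]
      exact List.Perm.append_left _ (List.perm_append_comm_assoc _ _ _)
    obtain ⟨h1, h2⟩ := perm_range_of_append hp' hqr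
    set i := (q.1 ++ q.2).length
    have hi : ∀ x ∈ r.1 ++ r.2, i ≤ x := by
      intro x hx
      obtain ⟨y, -, rfl⟩ := List.mem_map.1 (h2.mem_iff.1 hx)
      exact Nat.le_add_right i y
    obtain ⟨r₁, hr₁⟩ := exists_map_add_eq fun x hx => hi x (List.mem_append_left _ hx)
    obtain ⟨r₂, hr₂⟩ := exists_map_add_eq fun x hx => hi x (List.mem_append_right _ hx)
    refine ⟨⟨(i, (r.1 ++ r.2).length), q, (r₁, r₂)⟩, ?_, by simp [hr₁, hr₂]⟩
    simp only [Finset.mem_sigma, Finset.HasAntidiagonal.mem_antidiagonal, Finset.mem_product,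
      Set.Finite.mem_toFinset, labelled, Set.mem_ofPred_eq]
    refine ⟨by simpa only [List.length_range] using (List.length_append (as := q.1 ++ q.2)).symm.trans hp'.length_eq, ⟨hq, h1⟩, ?_, ?_⟩
    · rw [← hQ _ (hmono i)]
      simpa only [hr₁, hr₂] using hr
    · rw [← hr₁, ← hr₂, ← List.map_append] at h2
      simpa [← hr₁, ← hr₂] using (List.map_perm_map_iff (hinj i)).1 h2

/-! ### Uniqueness of the decompositions. -/

theorem append_min_inj {γ δ γ' δ' : List ℕ} {b b' : ℕ} (hn : (γ ++ [b] ++ δ).Nodup)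
    (h : γ ++ [b] ++ δ = γ' ++ [b'] ++ δ') (hb : ∀ x ∈ γ ++ δ, b ≤ x)
    (hb' : ∀ x ∈ γ' ++ δ', b' ≤ x) : γ = γ' ∧ b = b' ∧ δ = δ' := by
  obtain rfl : b = b' := by
    have h1 : b ∈ γ' ++ [b'] ++ δ' := h ▸ by simp
    have h2 : b' ∈ γ ++ [b] ++ δ := h ▸ by simp
    simp only [List.mem_append, List.mem_singleton] at h1 h2 hb hb'
    refine le_antisymm ?_ ?_
    · rcases h2 with (h2 | rfl) | h2
      exacts [hb b' (Or.inl h2), le_rfl, hb b' (Or.inr h2)]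
    · rcases h1 with (h1 | rfl) | h1
      exacts [hb' b (Or.inl h1), le_rfl, hb' b (Or.inr h1)]
  simp only [List.append_assoc, List.singleton_append] at h hn
  have hn' := List.nodup_middle.1 hn
  simp only [List.nodup_cons, List.mem_append, not_or] at hn'
  exact (List.append_cons_inj_of_notMem hn'.1.1 hn'.1.2).1 h

theorem uniqueSum_rightOnly {Q : List ℕ × List ℕ → Prop} :
    UniqueSum (Rooted RightOnly) Q := by
  rintro q r q' r' ⟨_, γ, b, rfl, ⟨rfl, -⟩, hb⟩ - ⟨_, γ', b', rfl, ⟨rfl, -⟩, hb'⟩ - h h' hn - e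
  simp only [List.nil_append] at *
  obtain ⟨rfl, rfl, -⟩ := append_min_inj hn e
    (by
      simp only [List.mem_append]
      rintro x (hx | hx)
      exacts [(hb x hx).le, (h b (by simp) x (by simp [hx])).le])
    (by
      simp only [List.mem_append]
      rintro x (hx | hx)
      exacts [(hb' x hx).le, (h' b' (by simp) x (by simp [hx])).le])
  rfl

theorem uniqueSum_isPoint {Q : List ℕ × List ℕ → Prop} : UniqueSum IsPoint Q := by
  rintro q r q' r' ⟨b, rfl⟩ - ⟨b', rfl⟩ - - - - e -
  simp only [List.singleton_append, List.cons.injEq] at e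
  rw [e.1]

/-- Two factorizations of a list agree if the left factor of each is disjoint from the right factor
of the other. -/
theorem append_inj_of_separated {l m l' m' : List ℕ} (h : l ++ m = l' ++ m')
    (h1 : ∀ x ∈ l, x ∉ m') (h2 : ∀ x ∈ l', x ∉ m) : l = l' := by
  rcases List.append_eq_append_iff.1 h with ⟨t, rfl, rfl⟩ | ⟨t, rfl, rfl⟩
  · obtain _ | ⟨x, t⟩ := t
    · simp
    · exact absurd (by simp) (h2 x (by simp))
  · obtain _ | ⟨x, t⟩ := t
    · simp
    · exact absurd (by simp) (h1 x (by simp))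

/-- The last entry b of the second list is common to both sums and separates in value the two parts
of the first list. -/
theorem uniqueSum_leftOnly {P : List ℕ × List ℕ → Prop} : UniqueSum LeftOnly (Rooted P) := by
  rintro ⟨α, _⟩ r ⟨α', _⟩ r' ⟨-, rfl⟩ ⟨α₁, γ, b, rfl, -, hb⟩ ⟨-, rfl⟩ ⟨α₁', γ', b', rfl, -, hb'⟩
    h h' - e e'
  simp only [List.append_nil, List.nil_append] at *
  obtain ⟨rfl, hbb⟩ := List.append_inj' e' rfl
  obtain rfl : b = b' := by simpa using hbb
  refine Prod.ext (append_inj_of_separated e (fun x hx hx' => ?_) fun x hx hx' => ?_) rfl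
  · exact lt_asymm (h x hx b (by simp)) (hb' x (by simp [hx']))
  · exact lt_asymm (h' x hx b (by simp)) (hb x (by simp [hx']))

/-- The minimum of the second list fixes γ, b and δ. The cut in the first list is then forced:
entries to its right exceed some entry of δ, entries to its left exceed none. -/
theorem uniqueSum_gapFilledAbove :
    UniqueSum (OrdinalSum LeftOnly (Rooted MaxSplit)) GapFilledAbove := by
  rintro q ⟨α₂, δ⟩ q' ⟨α₂', δ'⟩ ⟨⟨α₀, _⟩, _, ⟨-, rfl⟩, ⟨α₁, γ, b, rfl, -, hb⟩, hl, rfl⟩ ⟨-, hd⟩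
    ⟨⟨α₀', _⟩, _, ⟨-, rfl⟩, ⟨α₁', γ', b', rfl, -, hb'⟩, hl', rfl⟩ ⟨-, hd'⟩ h h' hn e e'
  simp only [List.nil_append] at *
  obtain ⟨rfl, rfl, rfl⟩ := append_min_inj hn e'
    (by
      simp only [List.mem_append]
      rintro x (hx | hx)
      exacts [(hb x (by simp [hx])).le, (h b (by simp) x (by simp [hx])).le])
    (by
      simp only [List.mem_append]
      rintro x (hx | hx)
      exacts [(hb' x (by simp [hx])).le, (h' b' (by simp) x (by simp [hx])).le])
  refine Prod.ext (append_inj_of_separated e (fun x hx hx' => ?_) fun x hx hx' => ?_) rfl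
  · obtain ⟨d, hd, hdx⟩ := hd' x hx'
    exact lt_asymm hdx (h x (List.mem_append_left _ hx) d (by simp [hd]))
  · obtain ⟨d, hd, hdx⟩ := hd x hx'
    exact lt_asymm hdx (h' x (List.mem_append_left _ hx) d (by simp [hd]))

/-! ### The functional equations. -/

/-- The 1 counts the empty list; in size n + 1 the maximum n is deleted and its position becomes the
cut of the pair. -/
theorem genFun_leftOnly : genFun LeftOnly = 1 + PowerSeries.X * genFun MaxSplit := by
  ext n
  obtain _ | n := n
  · rw [map_add, PowerSeries.coeff_zero_X_mul, genFun, PowerSeries.coeff_mk,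
      show labelled LeftOnly 0 = {([], [])} by
        ext p
        simp +contextual [labelled, LeftOnly, Prod.ext_iff, Avoids4312And3142]]
    simp
  rw [map_add, PowerSeries.coeff_succ_X_mul, genFun, genFun, PowerSeries.coeff_mk,
    PowerSeries.coeff_mk, PowerSeries.coeff_one, if_neg (Nat.succ_ne_zero n), zero_add]
  have hlt : ∀ {l : List ℕ}, l.Perm (List.range n) → ∀ x ∈ l, x < n := fun h x hx =>
    List.mem_range.1 (h.mem_iff.1 hx)
  rw [← Set.InjOn.ncard_image (s := labelled MaxSplit n)
    (f := fun p => (p.1 ++ n :: p.2, []))]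
  · congr 2
    ext ⟨α, β⟩
    simp only [labelled, LeftOnly, Set.mem_ofPred_eq, Set.mem_image, Prod.mk.injEq, Prod.exists]
    have key : ∀ α β : List ℕ,
        (α ++ n :: β).Perm (List.range (n + 1)) ↔ (α ++ β).Perm (List.range n) := by
      intro α β
      rw [List.range_succ, (List.perm_middle (l₁ := α)).congr_left,
        (List.perm_append_singleton n _).congr_right, List.perm_cons]
    constructor
    · rintro ⟨⟨h, rfl⟩, hp⟩
      rw [List.append_nil] at hp
      obtain ⟨α, β, rfl⟩ := List.append_of_mem (hp.mem_iff.2 (List.mem_range.2 n.lt_succ_self))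
      have hp' := (key α β).1 hp
      exact ⟨α, β, ⟨(avoids4312And3142_iff_maxSplit (hlt hp')).1 h, hp'⟩, rfl, rfl⟩
    · rintro ⟨α, β, ⟨h, hp⟩, rfl, rfl⟩
      exact ⟨⟨(avoids4312And3142_iff_maxSplit (hlt hp)).2 h, rfl⟩,
        by simpa using (key α β).2 hp⟩
  · rintro ⟨a, b⟩ ⟨-, hp⟩ ⟨c, d⟩ - h
    have h1 : n ∉ a ++ b := fun hm => lt_irrefl n (hlt hp n hm)
    simp only [List.mem_append, not_or] at h1
    have h2 := (List.append_cons_inj_of_notMem h1.1 h1.2).1 (Prod.mk.inj h).1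
    rw [h2.1, h2.2.2]

theorem genFun_rightOnly :
    genFun RightOnly = 1 + PowerSeries.X * genFun RightOnly * genFun RightOnly := by
  conv_lhs => rw [genFun_congr rightOnly_iff]
  rw [genFun_or, genFun_isNil, genFun_ordinalSum orderInvariant_rightOnly uniqueSum_rightOnly,
    genFun_rooted orderInvariant_rightOnly]
  rintro p rfl ⟨_, _, ⟨α, γ, b, rfl, -⟩, -, -, h⟩
  simp at h

theorem genFun_gapFilledAbove :
    genFun GapFilledAbove = 1 + PowerSeries.X * genFun RightOnly * genFun GapFilled := by
  rw [genFun_congr gapFilledAbove_iff, genFun_or, genFun_isNil,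
    genFun_ordinalSum orderInvariant_gapFilled uniqueSum_rightOnly,
    genFun_rooted orderInvariant_rightOnly]
  rintro p rfl ⟨_, _, ⟨α, γ, b, rfl, -⟩, -, -, h⟩
  simp at h

theorem genFun_gapFilled :
    genFun GapFilled = genFun GapFilledAbove + PowerSeries.X * genFun GapFilled := by
  conv_lhs => rw [genFun_congr gapFilled_iff]
  rw [genFun_or, genFun_ordinalSum orderInvariant_gapFilled uniqueSum_isPoint, genFun_isPoint]
  rintro p ⟨-, hd⟩ ⟨_, r, ⟨b, rfl⟩, -, hlt, rfl⟩
  obtain ⟨d, hd, hdb⟩ := hd b (by simp)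
  exact lt_asymm hdb (hlt b (by simp) d (List.mem_append_right _ (by simpa using hd)))

theorem genFun_maxSplit : genFun MaxSplit = genFun LeftOnly +
    genFun LeftOnly * (PowerSeries.X * genFun MaxSplit) * genFun GapFilledAbove := by
  conv_lhs => rw [genFun_congr maxSplit_iff]
  rw [genFun_or, genFun_ordinalSum orderInvariant_gapFilledAbove uniqueSum_gapFilledAbove,
    genFun_ordinalSum orderInvariant_maxSplit.rooted uniqueSum_leftOnly,
    genFun_rooted orderInvariant_maxSplit]
  rintro p ⟨-, h0⟩ ⟨_, _, ⟨_, _, -, ⟨α, γ, b, rfl, -⟩, -, rfl⟩, -, -, rfl⟩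
  simp at h0

/-! ### From permutations to lists. -/

/-- The one-line notation of a permutation. -/
def oneLine {n : ℕ} (π : Equiv.Perm (Fin n)) : List ℕ := List.ofFn fun i => (π i : ℕ)

theorem oneLine_injective {n : ℕ} : Function.Injective (oneLine (n := n)) := by
  intro π τ h
  ext i
  exact congrFun (List.ofFn_injective h) i

theorem oneLine_perm {n : ℕ} (π : Equiv.Perm (Fin n)) : (oneLine π).Perm (List.range n) := by
  rw [oneLine, List.perm_ext_iff_of_nodup _ List.nodup_range]
  · intro a
    simp only [List.mem_ofFn, List.mem_range]
    constructor
    · rintro ⟨i, rfl⟩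
      exact (π i).2
    · intro h
      exact ⟨π.symm ⟨a, h⟩, by simp⟩
  · exact List.nodup_ofFn.2 (Fin.val_injective.comp π.injective)

theorem exists_oneLine_eq {n : ℕ} {l : List ℕ} (h : l.Perm (List.range n)) :
    ∃ π : Equiv.Perm (Fin n), oneLine π = l := by
  have hlen : l.length = n := by simpa using h.length_eq
  subst hlen
  have hmem : ∀ i : Fin l.length, l.get i < l.length := fun i =>
    List.mem_range.1 (h.mem_iff.1 (l.get_mem i))
  have hinj : Function.Injective fun i : Fin l.length => (⟨l.get i, hmem i⟩ : Fin l.length) := by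
    intro i j hij
    exact List.nodup_iff_injective_get.1 (h.nodup_iff.2 List.nodup_range) (Fin.mk.inj hij)
  exact ⟨Equiv.ofBijective _ (Finite.injective_iff_bijective.1 hinj), by
    simp [oneLine, List.ofFn_getElem]⟩

/-- Occurrences of a pattern are the sublists of the one-line notation in the same order. -/
theorem containsPattern_iff {n k : ℕ} (π : Equiv.Perm (Fin n)) (σ : Equiv.Perm (Fin k)) :
    ContainsPattern π σ ↔ ∃ v : Fin k → ℕ, (List.ofFn v).Sublist (oneLine π) ∧
      ∀ i j, v i < v j ↔ σ i < σ j := by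
  constructor
  · rintro ⟨e, he⟩
    refine ⟨fun i => π (e i), ?_, he⟩
    rw [List.sublist_iff_exists_fin_orderEmbedding_get_eq]
    refine ⟨((Fin.castOrderIso (by simp)).toOrderEmbedding.trans e).trans
      (Fin.castOrderIso (by simp [oneLine])).toOrderEmbedding, fun i => ?_⟩
    simp [oneLine]
    rfl
  · rintro ⟨v, hv, hσ⟩
    obtain ⟨e, he⟩ := List.sublist_iff_exists_fin_orderEmbedding_get_eq.1 hv
    refine ⟨((Fin.castOrderIso (by simp)).toOrderEmbedding.trans e).trans
      (Fin.castOrderIso (by simp [oneLine])).toOrderEmbedding, fun i j => ?_⟩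
    have h : ∀ i : Fin k, v i = π (((Fin.castOrderIso (by simp)).toOrderEmbedding.trans e).trans
        (Fin.castOrderIso (by simp [oneLine])).toOrderEmbedding i) := by
      intro i
      have := he (Fin.cast (by simp) i)
      simp only [oneLine, List.get_ofFn] at this
      exact this
    rw [← hσ, h i, h j, Fin.lt_def]

theorem containsPattern_perm4312_iff {n : ℕ} (π : Equiv.Perm (Fin n)) :
    ContainsPattern π perm4312 ↔
      ∃ a b c d, a < b ∧ b < c ∧ c < d ∧ [d, c, a, b].Sublist (oneLine π) := by
  rw [containsPattern_iff]
  constructor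
  · rintro ⟨v, hv, h⟩
    refine ⟨v 2, v 3, v 1, v 0, (h 2 3).2 (by decide), (h 3 1).2 (by decide),
      (h 1 0).2 (by decide), by simpa using hv⟩
  · rintro ⟨a, b, c, d, hab, hbc, hcd, hs⟩
    refine ⟨![d, c, a, b], by simpa using hs, ?_⟩
    simp [Fin.forall_fin_succ, perm4312]
    omega

theorem containsPattern_perm3142_iff {n : ℕ} (π : Equiv.Perm (Fin n)) :
    ContainsPattern π perm3142 ↔
      ∃ a b c d, a < b ∧ b < c ∧ c < d ∧ [c, a, d, b].Sublist (oneLine π) := by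
  rw [containsPattern_iff]
  constructor
  · rintro ⟨v, hv, h⟩
    refine ⟨v 1, v 3, v 0, v 2, (h 1 3).2 (by decide), (h 3 0).2 (by decide),
      (h 0 2).2 (by decide), by simpa using hv⟩
  · rintro ⟨a, b, c, d, hab, hbc, hcd, hs⟩
    refine ⟨![c, a, d, b], by simpa using hs, ?_⟩
    simp [Fin.forall_fin_succ, perm3142]
    omega

theorem mem_avoiders_iff {n : ℕ} (π : Equiv.Perm (Fin n)) :
    π ∈ avoiders {⟨4, perm4312⟩, ⟨4, perm3142⟩} n ↔ Avoids4312And3142 (oneLine π) := by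
  simp only [avoiders, Set.mem_insert_iff, Set.mem_singleton_iff, Set.mem_ofPred_eq,
    forall_eq_or_imp, forall_eq, containsPattern_perm4312_iff, containsPattern_perm3142_iff,
    Avoids4312And3142]
  grind

theorem ncard_labelled_leftOnly (n : ℕ) : (labelled LeftOnly n).ncard =
    (avoiders {⟨4, perm4312⟩, ⟨4, perm3142⟩} n).ncard := by
  rw [← Set.ncard_image_of_injective (f := fun π => (oneLine π, ([] : List ℕ)))]
  · congr 1
    ext ⟨α, β⟩
    simp only [labelled, LeftOnly, Set.mem_ofPred_eq, Set.mem_image, Prod.mk.injEq,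
      mem_avoiders_iff]
    constructor
    · rintro ⟨⟨h, rfl⟩, hp⟩
      obtain ⟨π, rfl⟩ := exists_oneLine_eq (by simpa using hp)
      exact ⟨π, h, rfl, rfl⟩
    · rintro ⟨π, h, rfl, rfl⟩
      exact ⟨⟨h, rfl⟩, by simpa using oneLine_perm π⟩
  · exact fun π τ h => oneLine_injective (Prod.mk.inj h).1

theorem genFun_leftOnly_eq :
    genFun LeftOnly = 1 + avGenFun {⟨4, perm4312⟩, ⟨4, perm3142⟩} := by
  ext n
  obtain _ | n := n
  · rw [genFun_leftOnly]
    simp [avGenFun]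
  · simp [genFun, avGenFun, ncard_labelled_leftOnly, PowerSeries.coeff_one]

/-! ### Elimination. -/

open PowerSeries in
theorem theorem4p2 (f : PowerSeries ℤ)
    (hf : f = avGenFun {⟨4, perm4312⟩, ⟨4, perm3142⟩}) :
    (X ^ 3 - 2 * X ^ 2 + X) * f ^ 4
      + (4 * X ^ 3 - 9 * X ^ 2 + 6 * X - 1) * f ^ 3
      + (6 * X ^ 3 - 12 * X ^ 2 + 7 * X - 1) * f ^ 2
      + (4 * X ^ 3 - 5 * X ^ 2 + X) * f
      + X ^ 3 = 0 := by
  have hF : genFun LeftOnly = 1 + f := hf ▸ genFun_leftOnly_eq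
  have hA := genFun_leftOnly
  have hM := genFun_maxSplit
  have hC := genFun_rightOnly
  have hD := genFun_gapFilledAbove
  have hE := genFun_gapFilled
  rw [hF] at hA hM
  generalize genFun MaxSplit = A at *
  generalize genFun RightOnly = c at *
  generalize genFun GapFilledAbove = D at *
  generalize genFun GapFilled = E at *
  obtain rfl : f = X * A := add_left_cancel hA
  have hE' : E * (1 - X - X * c) = 1 := by linear_combination hE + hD
  have hD' : D * (1 - X - X * c) = 1 - X := by
    linear_combination (1 - X) * hE' - (1 - X - X * c) * hE
  set f := X * A with hf'
  -- The equation for A times x, with the denominator of D = (1 - x)/(1 - x - xc) cleared.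
  have hM' : (f - X * (1 + f)) * (1 - X - X * c) = X * (1 + f) * f * (1 - X) := by
    linear_combination (1 - X - X * c) * hf' + X * (1 - X - X * c) * hM + X * (1 + f) * f * hD'
  have hXc : X * c * (f - X * (1 + f)) = (1 - X) * (f - X * (1 + f) - X * (1 + f) * f) := by
    linear_combination -hM'
  -- Put u = f - x(1 + f) and w = (1 - x)(u - x(1 + f)f), so that xc·u = w. Multiplying c = 1 + xc²
  -- by xu² gives xu² - uw + w² = 0, whose left side is x times the quartic.
  refine (mul_eq_zero.1 ?_).resolve_left (PowerSeries.X_ne_zero (R := ℤ))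
  linear_combination -X * (f - X * (1 + f)) ^ 2 * hC + (f - X * (1 + f)) * hXc -
    (X * c * (f - X * (1 + f)) + (1 - X) * (f - X * (1 + f) - X * (1 + f) * f)) * hXc
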